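/- Let $q$ be a prime power, $n\ge 2$, let $V$ be an $n$-dimensional vector space over the finite field $\mathbb{F}_q$, and let $B$ be a symmetric non-degenerate bilinear form on $V$. A subspace $C\le V$ is self-orthogonal if $C\subseteq C^\perp=\{v\in V: B(v,w)=0 \text{ for all } w\in C\}$. Let $w(V,B)$ (the Witt index) be the largest dimension of a self-orthogonal subspace, let $\sigma(V,B,k)$ be the number of $k$-dimensional self-orthogonal subspaces of $V$, and let ${n\brack k}_q$ be the number of all $k$-dimensional subspaces of $V$. For odd $q$, $(V,B)$ is of type (P) if $n$ is odd, of type (H) if $n$ is even and $w(V,B)=n/2$, and of type (E) if $n$ is even and $w(V,B)=n/2-1$. For even $q$, $(V,B)$ is of type (N$_1$) if $n$ is odd, of type (N$_{0,a}$) if $n$ is even and $B$ is alternating (that is, $B(v,v)=0$ for all $v\in V$), and of type (N$_{0,na}$) if $n$ is even and $B$ is not alternating. Fix $n\ge 2$, $k\ge 1$ and a type. As $q\to\infty$, where $(V,B)$ ranges over the $n$-dimensional bilinear spaces over $\mathbb{F}_q$ of the given type with $k\le w(V,B)$, we have \[ \frac{\sigma(V,B,k)}{{n\brack k}_q}\sim\begin{cases}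 q^{-\binom{k+1}{2}} & \text{for types (P), (N$_1$), (N$_{0,na}$), (E), and for type (H) if } k<n/2,\\ 2\,q^{-\binom{k+1}{2}} & \text{for type (H) if } k=n/2,\\ q^{\,k-\binom{k+1}{2}} & \text{for type (N$_{0,a}$)}. \end{cases} \] Here $\sim$ means that the quotient of the two sides tends to $1$: for every $\varepsilon>0$ there is a $q_0$, depending only on $\varepsilon$, $n$, $k$ and the type, such that for all such $(V,B)$ with $q\ge q_0$ the quotient of the left-hand side by the right-hand side differs from $1$ by less than $\varepsilon$. -/

import Mathlib

universe u v

namespace BilinSpace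

/-- A subspace `C` is self-orthogonal (totally isotropic) if `C ⊆ C^⊥`. -/
def SelfOrthogonal {F : Type u} {V : Type v} [Field F] [AddCommGroup V] [Module F V]
    (B : LinearMap.BilinForm F V) (C : Submodule F V) : Prop :=
  C ≤ B.orthogonal C

/-- `σ(V, B, k)`: the number of `k`-dimensional self-orthogonal subspaces. -/
noncomputable def sigma {F : Type u} {V : Type v} [Field F] [AddCommGroup V] [Module F V]
    (B : LinearMap.BilinForm F V) (k : ℕ) : ℕ :=
  Set.ncard {C : Submodule F V | Module.finrank F C = k ∧ SelfOrthogonal B C}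

/-- The number of all `k`-dimensional subspaces of `V`. This is the `q`-binomial coefficient
`[n, k]_q` when `V` has dimension `n` over a field with `q` elements. -/
noncomputable def subspaceCount (F : Type u) (V : Type v) [Field F] [AddCommGroup V] [Module F V]
    (k : ℕ) : ℕ :=
  Set.ncard {C : Submodule F V | Module.finrank F C = k}

/-- The Witt index `w(V, B)`: the largest dimension of a self-orthogonal subspace. For
finite-dimensional `V` the set below is bounded by `dim V` and contains `0`, so that the supremum
is a maximum. -/
noncomputable def wittIndex {F : Type u} {V : Type v} [Field F] [AddCommGroup V] [Module F V]
    (B : LinearMap.BilinForm F V) : ℕ :=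
  sSup {d : ℕ | ∃ C : Submodule F V, SelfOrthogonal B C ∧ Module.finrank F C = d}

/-- The six types of bilinear spaces: parabolic, hyperbolic, elliptic (`q` odd), and
`N₁`, `N_{0,a}`, `N_{0,na}` (`q` even). -/
inductive SpaceType
  | P
  | H
  | E
  | N1
  | N0a
  | N0na

/-- `IsOfType B T` says that the bilinear space `(V, B)` over the finite field `F` is of
type `T`. -/
def IsOfType {F : Type u} {V : Type v} [Field F] [AddCommGroup V] [Module F V]
    (B : LinearMap.BilinForm F V) : SpaceType → Prop
  | .P => Odd (Nat.card F) ∧ Odd (Module.finrank F V)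
  | .H => Odd (Nat.card F) ∧ Even (Module.finrank F V) ∧
      wittIndex B = Module.finrank F V / 2
  | .E => Odd (Nat.card F) ∧ Even (Module.finrank F V) ∧
      wittIndex B + 1 = Module.finrank F V / 2
  | .N1 => Even (Nat.card F) ∧ Odd (Module.finrank F V)
  | .N0a => Even (Nat.card F) ∧ Even (Module.finrank F V) ∧ B.IsAlt
  | .N0na => Even (Nat.card F) ∧ Even (Module.finrank F V) ∧ ¬ B.IsAlt

/-- `σ(V, B, k) / [n, k]_q ∼ g(q)` for `q → ∞`, where `(V, B)` ranges over the `n`-dimensional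
symmetric, non-degenerate bilinear spaces of type `T` with `k ≤ w(V, B)` over finite fields: the
quotient of both sides tends to `1` as the cardinality `q` of the field tends to infinity, `n`, `k`
and `T` being fixed. -/
def ProportionAsymp (T : SpaceType) (n k : ℕ) (g : ℝ → ℝ) : Prop :=
  ∀ ε : ℝ, 0 < ε → ∃ q₀ : ℕ,
    ∀ (F : Type u) [Field F] [Finite F] (V : Type v) [AddCommGroup V] [Module F V]
      [FiniteDimensional F V] (B : LinearMap.BilinForm F V),
      q₀ ≤ Nat.card F → Module.finrank F V = n → B.IsSymm → B.Nondegenerate →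
      IsOfType B T → k ≤ wittIndex B →
      |((sigma B k : ℝ) / (subspaceCount F V k : ℝ)) / g (Nat.card F : ℝ) - 1| < ε

end BilinSpace

namespace BilinSpace

open Module Submodule

/-! ### Self-orthogonal subspaces, orthogonal complements and the Witt index. -/

section Algebra

variable {F : Type*} {V : Type*} [Field F] [AddCommGroup V] [Module F V]
  {B : LinearMap.BilinForm F V}

/-! All `k`-dimensional subspaces have equally many ordered bases, so the proportion of
self-orthogonal subspaces is the proportion of self-orthogonal linearly independent `k`-tuples
(`sigma_div_subspaceCount`). Tuples are built one vector at a time. Without the orthogonality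
condition each step has `q ^ n * (1 + O(1/q))` choices. A self-orthogonal `U` of dimension `j` is
extended by the isotropic vectors of `U^⊥` outside `U`, and `U^⊥` has dimension `n - j`.

For odd `q`, isotropy is one quadratic equation and leaves about `q ^ (n - j - 1)` choices
(`mul_ncard_extensions_bounds`); these exponents add up to `n * k - (k + 1).choose 2`. The exception
is the last step when `2 * k = n`: there `U^⊥ / U` is a hyperbolic plane, and its two isotropic
lines produce the factor `2` (`ncard_extensions_of_two_mul_eq`). For alternating `B` isotropy is no
condition, and each step gains a factor `q`.

For even `q` and `B` not alternating, the isotropic vectors form a hyperplane. It cuts `U^⊥` down by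
one dimension unless it contains `U^⊥`. Such exceptional `U` have `q` times more isotropic vectors
in `U^⊥`, but they make up only a fraction of order `q ^ (2 * j - n)` (`aniso_bounds`), which is
negligible because `2 * k ≤ n`. -/

theorem selfOrthogonal_iff {C : Submodule F V} :
    SelfOrthogonal B C ↔ ∀ x ∈ C, ∀ y ∈ C, B x y = 0 :=
  ⟨fun h x hx _ hy => h hy x hx, fun h y hy x hx => h x hx y hy⟩

theorem SelfOrthogonal.mono {C D : Submodule F V} (hD : SelfOrthogonal B D) (h : C ≤ D) :
    SelfOrthogonal B C :=
  selfOrthogonal_iff.2 fun x hx y hy => selfOrthogonal_iff.1 hD x (h hx) y (h hy)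

theorem selfOrthogonal_span_singleton_sup_iff (hs : B.IsSymm) {U : Submodule F V}
    (hU : SelfOrthogonal B U) (v : V) :
    SelfOrthogonal B (span F {v} ⊔ U) ↔ v ∈ B.orthogonal U ∧ B v v = 0 := by
  rw [selfOrthogonal_iff] at hU ⊢
  have hv : v ∈ span F {v} ⊔ U := mem_sup_left (mem_span_singleton_self v)
  refine ⟨fun h => ⟨fun u hu => h u (mem_sup_right hu) v hv, h v hv v hv⟩, ?_⟩
  rintro ⟨h1, h2⟩ x hx y hy
  obtain ⟨x', hx', a, ha, rfl⟩ := mem_sup.1 hx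
  obtain ⟨y', hy', b, hb, rfl⟩ := mem_sup.1 hy
  obtain ⟨c, rfl⟩ := mem_span_singleton.1 hx'
  obtain ⟨d, rfl⟩ := mem_span_singleton.1 hy'
  have h3 : B a v = 0 := h1 a ha
  have h4 : B v b = 0 := by rw [hs.eq]; exact h1 b hb
  simp [h2, h3, h4, hU a ha b hb]

theorem finrank_span_singleton_sup [FiniteDimensional F V] {U : Submodule F V} {v : V}
    (hv : v ∉ U) : finrank F (span F {v} ⊔ U : Submodule F V) = finrank F U + 1 := by
  have h := finrank_sup_add_finrank_inf_eq (span F {v}) U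
  have hv0 : v ≠ 0 := fun h => hv (h ▸ U.zero_mem)
  have : span F {v} ⊓ U = ⊥ := by
    rw [← disjoint_iff, disjoint_comm, disjoint_span_singleton' hv0]
    exact hv
  rw [this, finrank_bot, finrank_span_singleton hv0] at h
  omega

theorem mem_orthogonal_span_singleton_sup {U : Submodule F V} {e v : V} :
    v ∈ B.orthogonal (span F {e} ⊔ U) ↔ B e v = 0 ∧ v ∈ B.orthogonal U := by
  refine ⟨fun h => ⟨h e (mem_sup_left (mem_span_singleton_self e)),
    fun u hu => h u (mem_sup_right hu)⟩, ?_⟩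
  rintro ⟨h1, h2⟩ x hx
  obtain ⟨x', hx', a, ha, rfl⟩ := mem_sup.1 hx
  obtain ⟨c, rfl⟩ := mem_span_singleton.1 hx'
  have h3 : B a v = 0 := h2 a ha
  simp [h1, h3]

/-- In characteristic different from two, a subspace on which the quadratic form vanishes is
self-orthogonal. -/
theorem selfOrthogonal_of_apply_self_eq_zero (hs : B.IsSymm) (h2 : (2 : F) ≠ 0)
    {W : Submodule F V} (h : ∀ w ∈ W, B w w = 0) : SelfOrthogonal B W := by
  rw [selfOrthogonal_iff]
  intro x hx y hy
  have h3 := h (x + y) (W.add_mem hx hy)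
  simp only [map_add, LinearMap.add_apply, h x hx, h y hy, hs.eq y x] at h3
  have : 2 * B x y = 0 := by linear_combination h3
  exact (mul_eq_zero.1 this).resolve_left h2

variable [FiniteDimensional F V]

theorem finrank_add_finrank_orthogonal_eq (hn : B.Nondegenerate) (U : Submodule F V) :
    finrank F U + finrank F (B.orthogonal U) = finrank F V := by
  rw [LinearMap.BilinForm.finrank_orthogonal hn]
  have := finrank_le U
  omega

theorem SelfOrthogonal.two_mul_finrank_le (hn : B.Nondegenerate) {C : Submodule F V}
    (hC : SelfOrthogonal B C) : 2 * finrank F C ≤ finrank F V := by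
  have h1 := finrank_add_finrank_orthogonal_eq hn C
  have h2 := finrank_mono hC
  omega

theorem exists_selfOrthogonal_finrank_eq_wittIndex (B : LinearMap.BilinForm F V) :
    ∃ C : Submodule F V, SelfOrthogonal B C ∧ finrank F C = wittIndex B := by
  refine Nat.sSup_mem (s := {d : ℕ | ∃ C : Submodule F V, SelfOrthogonal B C ∧ finrank F C = d})
    ⟨0, ⊥, bot_le, finrank_bot F V⟩ ⟨finrank F V, ?_⟩
  rintro d ⟨C, -, rfl⟩
  exact finrank_le C

theorem two_mul_le_of_le_wittIndex (hn : B.Nondegenerate) {k : ℕ} (hk : k ≤ wittIndex B) :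
    2 * k ≤ finrank F V := by
  obtain ⟨C, hC, h⟩ := exists_selfOrthogonal_finrank_eq_wittIndex B
  have := hC.two_mul_finrank_le hn
  omega

/-- A self-orthogonal subspace of dimension below the Witt index can be enlarged. -/
theorem exists_isotropic_of_finrank_lt_wittIndex (hs : B.IsSymm) (hn : B.Nondegenerate)
    {U : Submodule F V} (h : finrank F U < wittIndex B) :
    ∃ e ∈ B.orthogonal U, e ∉ U ∧ B e e = 0 := by
  obtain ⟨C, hC, hCw⟩ := exists_selfOrthogonal_finrank_eq_wittIndex B
  by_contra! hcon
  -- This inclusion is impossible for dimension reasons: the dimension of `U^⊥ ∩ C` exceeds that of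
  -- `U ∩ C^⊥` by `dim C - dim U > 0`. No form of Witt's extension theorem is needed.
  have hle : B.orthogonal U ⊓ C ≤ U ⊓ B.orthogonal C := by
    intro x hx
    refine ⟨?_, hC hx.2⟩
    by_contra hxU
    exact hcon x hx.1 hxU (selfOrthogonal_iff.1 hC x hx.2 x hx.2)
  have horth : B.orthogonal (U ⊔ B.orthogonal C) ≤ B.orthogonal U ⊓ C := by
    refine le_inf (LinearMap.BilinForm.orthogonal_le le_sup_left) ?_
    exact (LinearMap.BilinForm.orthogonal_le le_sup_right).trans
      (LinearMap.BilinForm.orthogonal_orthogonal hn hs.isRefl C).le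
  have h1 := finrank_mono (horth.trans hle)
  have h2 := finrank_add_finrank_orthogonal_eq hn (U ⊔ B.orthogonal C)
  have h3 := finrank_sup_add_finrank_inf_eq U (B.orthogonal C)
  have h4 := finrank_add_finrank_orthogonal_eq hn C
  omega

/-- Otherwise `U^⊥` would be self-orthogonal by polarization, while its dimension is more than half
of `dim V`. -/
theorem exists_apply_self_ne_zero (hs : B.IsSymm) (hn : B.Nondegenerate) (h2 : (2 : F) ≠ 0)
    {U : Submodule F V} (hU : 2 * finrank F U < finrank F V) :
    ∃ w ∈ B.orthogonal U, B w w ≠ 0 := by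
  by_contra! hcon
  have h1 := (selfOrthogonal_of_apply_self_eq_zero hs h2 hcon).two_mul_finrank_le hn
  have h4 := finrank_add_finrank_orthogonal_eq hn U
  omega

theorem orthogonal_eq_self (hn : B.Nondegenerate) {U : Submodule F V} (hU : SelfOrthogonal B U)
    (h : 2 * finrank F U = finrank F V) : B.orthogonal U = U := by
  refine (eq_of_le_of_finrank_eq hU ?_).symm
  have h4 := finrank_add_finrank_orthogonal_eq hn U
  omega

/-- A non-degenerate alternating form lives on a space of even dimension. -/
theorem even_finrank_of_isAlt (hs : B.IsSymm) (hn : B.Nondegenerate) (ha : B.IsAlt) :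
    Even (finrank F V) := by
  obtain ⟨C, hC, h⟩ := exists_selfOrthogonal_finrank_eq_wittIndex B
  -- All vectors are isotropic, so a vector of `C^⊥` outside `C` would enlarge `C` beyond the Witt
  -- index. Hence `C = C^⊥`.
  have hle : B.orthogonal C ≤ C := by
    intro v hv
    by_contra hvC
    have h1 : SelfOrthogonal B (span F {v} ⊔ C) :=
      (selfOrthogonal_span_singleton_sup_iff hs hC v).2 ⟨hv, ha v⟩
    have h2 : finrank F (span F {v} ⊔ C : Submodule F V) ≤ wittIndex B := by
      refine le_csSup ⟨finrank F V, ?_⟩ ⟨_, h1, rfl⟩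
      rintro d ⟨D, -, rfl⟩
      exact finrank_le D
    rw [finrank_span_singleton_sup hvC] at h2
    omega
  have h4 := finrank_add_finrank_orthogonal_eq hn C
  rw [le_antisymm hle hC] at h4
  exact ⟨_, h4.symm⟩

theorem ncard_submodule (C : Submodule F V) : (C : Set V).ncard = Nat.card F ^ finrank F C := by
  rw [← Module.natCard_eq_pow_finrank (K := F) (V := C)]
  rfl

end Algebra

/-! ### Counting zeros of the quadratic form `B v v`. -/

section Count

variable {F : Type*} {V : Type*} [Field F] [Finite F] [AddCommGroup V] [Module F V]
  [FiniteDimensional F V] {B : LinearMap.BilinForm F V}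

theorem finite_of_finiteDimensional (F V : Type*) [Field F] [Finite F] [AddCommGroup V]
    [Module F V] [FiniteDimensional F V] : Finite V :=
  Module.finite_of_finite F

/-- The isotropic vectors in `U^⊥`. -/
def isotropicPerp (B : LinearMap.BilinForm F V) (U : Submodule F V) : Set V :=
  {v | v ∈ B.orthogonal U ∧ B v v = 0}

/-- Translate along `e`: as `e` is isotropic, `B (v + t • e) (v + t • e)` is affine in `t` with
slope `2 * B e v`. If `B e v ≠ 0`, each line `v + F e` therefore has exactly one isotropic point.
The vectors with `B e v = 0` are those of `(span F {e} ⊔ U)^⊥` and are counted separately. -/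
theorem ncard_isotropicPerp_eq (hs : B.IsSymm) (hn : B.Nondegenerate) (h2 : (2 : F) ≠ 0)
    {U : Submodule F V} {e : V} (he : e ∈ B.orthogonal U) (heU : e ∉ U) (hee : B e e = 0) :
    Nat.card F * (isotropicPerp B U).ncard + Nat.card F ^ (finrank F V - finrank F U - 1) =
      Nat.card F ^ (finrank F V - finrank F U) +
        Nat.card F * (isotropicPerp B (span F {e} ⊔ U)).ncard := by
  have := finite_of_finiteDimensional F V
  set U' := span F {e} ⊔ U with hU'
  have hr : finrank F (B.orthogonal U') = finrank F V - finrank F U - 1 := by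
    have h1 := finrank_add_finrank_orthogonal_eq hn U'
    rw [finrank_span_singleton_sup heU] at h1
    omega
  have hr' : finrank F (B.orthogonal U) = finrank F V - finrank F U := by
    have h1 := finrank_add_finrank_orthogonal_eq hn U
    omega
  have hsub : isotropicPerp B U' ⊆ isotropicPerp B U := fun v hv =>
    ⟨(mem_orthogonal_span_singleton_sup.1 hv.1).2, hv.2⟩
  have hsub' : (B.orthogonal U' : Set V) ⊆ B.orthogonal U := fun v hv =>
    (mem_orthogonal_span_singleton_sup.1 hv).2
  have e1 := Set.ncard_sdiff_add_ncard_of_subset hsub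
  have e2 := Set.ncard_sdiff_add_ncard_of_subset hsub'
  rw [ncard_submodule, ncard_submodule, hr, hr'] at e2
  have key : Nat.card F * (isotropicPerp B U \ isotropicPerp B U').ncard =
      ((B.orthogonal U : Set V) \ B.orthogonal U').ncard := by
    rw [← Nat.card_coe_set_eq, ← Nat.card_coe_set_eq, ← Nat.card_prod]
    have hmem : ∀ v : V, v ∈ (isotropicPerp B U \ isotropicPerp B U') ↔
        v ∈ B.orthogonal U ∧ B v v = 0 ∧ B e v ≠ 0 := by
      intro v
      simp only [isotropicPerp, Set.mem_sdiff, Set.mem_ofPred_eq, hU',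
        mem_orthogonal_span_singleton_sup]
      tauto
    have hmem' : ∀ v : V, v ∈ ((B.orthogonal U : Set V) \ B.orthogonal U') ↔
        v ∈ B.orthogonal U ∧ B e v ≠ 0 := by
      intro v
      simp only [Set.mem_sdiff, SetLike.mem_coe, hU', mem_orthogonal_span_singleton_sup]
      tauto
    have hcalc : ∀ (v : V) (t : F), B (v + t • e) (v + t • e) = B v v + 2 * t * B e v := by
      intro v t
      simp only [map_add, map_smul, LinearMap.add_apply, LinearMap.smul_apply, smul_eq_mul, hee,
        hs.eq v e]
      ring
    have hcalc' : ∀ (v : V) (t : F), B e (v + t • e) = B e v := by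
      intro v t
      simp [hee]
    refine Nat.card_eq_of_bijective (fun p => ⟨p.2.1 + p.1 • e, ?_⟩) ⟨?_, ?_⟩
    · have := (hmem _).1 p.2.2
      exact (hmem' _).2 ⟨add_mem this.1 (smul_mem _ _ he), by rw [hcalc']; exact this.2.2⟩
    · rintro ⟨t, v, hv⟩ ⟨s, w, hw⟩ h
      simp only [Subtype.mk.injEq] at h
      have hv' := (hmem _).1 hv
      have hw' := (hmem _).1 hw
      have h3 := congrArg (fun x => B x x) h
      have h4 := congrArg (fun x => B e x) h
      simp only [hcalc, hcalc', hv'.2.1, hw'.2.1, zero_add] at h3 h4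
      rw [h4] at h3
      have hts : t = s := mul_left_cancel₀ h2 (mul_right_cancel₀ hw'.2.2 h3)
      subst hts
      simpa using h
    · rintro ⟨v, hv⟩
      have hv' := (hmem' _).1 hv
      set t := B v v / (2 * B e v) with ht
      have h5 : v + (-t) • e ∈ (isotropicPerp B U \ isotropicPerp B U') := by
        refine (hmem _).2 ⟨add_mem hv'.1 (smul_mem _ _ he), ?_, by rw [hcalc']; exact hv'.2⟩
        rw [hcalc, ht]
        have := hv'.2
        field_simp
        ring
      exact ⟨⟨t, ⟨_, h5⟩⟩, by simp⟩
  rw [← e1, ← e2, mul_add, key]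
  ring

/-- A nonzero quadratic form on `W` has at most `2 q ^ (dim W - 1)` zeros. -/
theorem card_mul_ncard_zeros_le (W : Submodule F V) {w : V} (hw : w ∈ W) (hww : B w w ≠ 0) :
    Nat.card F * {v | v ∈ W ∧ B v v = 0}.ncard ≤ 2 * Nat.card F ^ finrank F W := by
  have := finite_of_finiteDimensional F V
  rw [← ncard_submodule, ← Nat.card_coe_set_eq, ← Nat.card_coe_set_eq, ← Nat.card_prod]
  -- `Z v` parametrizes the zeros on the line through `v` in direction `w`. They are roots of a
  -- quadratic polynomial with leading coefficient `B w w ≠ 0`, so there are at most two.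
  let Z : W → Set F := fun v => {t | B (v + t • w) (v + t • w) = 0}
  have hinj : Nat.card (F × {v | v ∈ W ∧ B v v = 0}) ≤ Nat.card (Σ v : W, Z v) := by
    refine Nat.card_le_card_of_injective
      (fun p => ⟨⟨p.2.1 - p.1 • w, sub_mem p.2.2.1 (smul_mem _ _ hw)⟩, p.1, ?_⟩) ?_
    · change B (p.2.1 - p.1 • w + p.1 • w) (p.2.1 - p.1 • w + p.1 • w) = 0
      rw [sub_add_cancel]
      exact p.2.2.2
    · rintro ⟨t, v, hv⟩ ⟨s, u, hu⟩ h
      simp only [Sigma.mk.injEq] at h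
      obtain ⟨h1, h2⟩ := h
      have h3 : t = s := by
        have hZ : ∀ (a b : W) (x : Z a) (y : Z b), a = b → HEq x y → (x : F) = y := by
          rintro a b x y rfl h
          rw [eq_of_heq h]
        exact hZ _ _ _ _ h1 h2
      subst h3
      simp only [Subtype.mk.injEq, sub_left_inj] at h1
      subst h1
      rfl
  refine hinj.trans ?_
  have hZ : ∀ v : W, Nat.card (Z v) ≤ 2 := by
    intro v
    open Polynomial in
    let p : F[X] := C (B w w) * X ^ 2 + C (B v w + B w v) * X + C (B v v)
    have hp : p.natDegree = 2 := Polynomial.natDegree_quadratic hww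
    have hp0 : p ≠ 0 := by
      intro h
      rw [h] at hp
      simp at hp
    have hsub : Z v ⊆ p.rootSet F := by
      intro t ht
      rw [Polynomial.mem_rootSet]
      refine ⟨hp0, ?_⟩
      simp only [Z, Set.mem_ofPred_eq, map_add, map_smul, LinearMap.add_apply,
        LinearMap.smul_apply, smul_eq_mul] at ht
      simp only [p, map_add, map_mul, Polynomial.aeval_X, Polynomial.aeval_C, map_pow,
        Algebra.algebraMap_self, RingHom.id_apply]
      linear_combination ht
    rw [Nat.card_coe_set_eq, ← hp]
    exact (Set.ncard_le_ncard hsub).trans (Polynomial.ncard_rootSet_le p F)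
  have := Fintype.ofFinite W
  rw [Nat.card_sigma]
  calc ∑ v : W, Nat.card (Z v) ≤ ∑ _v : W, 2 := Finset.sum_le_sum fun v _ => hZ v
    _ = _ := by
      rw [Finset.sum_const, Finset.card_univ, ← Nat.card_eq_fintype_card, smul_eq_mul, mul_comm]
      rfl

end Count

/-! ### Characteristic two: the hyperplane of isotropic vectors. -/

section CharTwo

variable {F : Type*} {V : Type*} [Field F] [AddCommGroup V] [Module F V]
  {B : LinearMap.BilinForm F V}

/-- In characteristic two the isotropic vectors form a subspace. -/
def isotropicSubmodule (B : LinearMap.BilinForm F V) (hs : B.IsSymm) (h2 : (2 : F) = 0) :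
    Submodule F V where
  carrier := {v | B v v = 0}
  zero_mem' := by simp
  add_mem' := by
    intro a b ha hb
    simp only [Set.mem_ofPred_eq] at ha hb ⊢
    simp only [map_add, LinearMap.add_apply, ha, hb, hs.eq b a]
    linear_combination B a b * h2
  smul_mem' := by
    intro c a ha
    simp only [Set.mem_ofPred_eq] at ha ⊢
    simp [ha]

theorem mem_isotropicSubmodule {hs : B.IsSymm} {h2 : (2 : F) = 0} {v : V} :
    v ∈ isotropicSubmodule B hs h2 ↔ B v v = 0 := Iff.rfl

/-- Every element of a finite field of characteristic two is a square. With `c ^ 2 = B v v / B w w`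
the vector `v - c • w` is isotropic, so the isotropic vectors have codimension one. -/
theorem span_singleton_sup_isotropicSubmodule [Finite F] {hs : B.IsSymm} {h2 : (2 : F) = 0}
    {w : V} (hw : B w w ≠ 0) : span F {w} ⊔ isotropicSubmodule B hs h2 = ⊤ := by
  rw [eq_top_iff]
  intro v _
  have : CharP F 2 := CharTwo.of_one_ne_zero_of_two_eq_zero one_ne_zero h2
  obtain ⟨c, hc⟩ := FiniteField.isSquare_of_char_two (ringChar.eq F 2) (B v v / B w w)
  rw [div_eq_iff hw] at hc
  refine mem_sup.2 ⟨c • w, mem_span_singleton.2 ⟨c, rfl⟩, v - c • w, ?_, by abel⟩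
  rw [mem_isotropicSubmodule]
  simp only [map_sub, map_smul, LinearMap.sub_apply, LinearMap.smul_apply, smul_eq_mul, hc,
    hs.eq v w]
  linear_combination (c * c * B w w - c * B w v) * h2

theorem finrank_inf_isotropicSubmodule [Finite F] [FiniteDimensional F V] {hs : B.IsSymm}
    {h2 : (2 : F) = 0} {W : Submodule F V} (hW : ¬ W ≤ isotropicSubmodule B hs h2) :
    finrank F (W ⊓ isotropicSubmodule B hs h2 : Submodule F V) + 1 = finrank F W := by
  obtain ⟨w, hwW, hw⟩ := SetLike.not_le_iff_exists.1 hW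
  have h1 := finrank_span_singleton_sup hw
  rw [span_singleton_sup_isotropicSubmodule hw, finrank_top] at h1
  have h3 := finrank_sup_add_finrank_inf_eq W (isotropicSubmodule B hs h2)
  have h4 : W ⊔ isotropicSubmodule B hs h2 = ⊤ := by
    rw [eq_top_iff, ← span_singleton_sup_isotropicSubmodule (hs := hs) (h2 := h2) hw]
    exact sup_le_sup_right ((span_singleton_le_iff_mem w W).2 hwW) _
  rw [h4, finrank_top] at h3
  omega

end CharTwo

end BilinSpace
namespace BilinSpace

open Module Submodule

/-! ### From subspaces to ordered bases, built one vector at a time. -/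

section Tuples

variable {F : Type*} {V : Type*} [Field F] [AddCommGroup V] [Module F V]

/-- Linearly independent `j`-tuples whose span satisfies `P`. -/
def tuples (P : Submodule F V → Prop) (j : ℕ) : Set (Fin j → V) :=
  {f | LinearIndependent F f ∧ P (span F (Set.range f))}

/-- The vectors by which a basis of `U` can be extended to a basis of a subspace with `P`. -/
def extensions (P : Submodule F V → Prop) (U : Submodule F V) : Set V :=
  {v | v ∉ U ∧ P (span F {v} ⊔ U)}

theorem span_range_cons {j : ℕ} (v : V) (f : Fin j → V) :
    span F (Set.range (Fin.cons v f : Fin (j + 1) → V)) =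
      span F {v} ⊔ span F (Set.range f) := by
  rw [Fin.range_cons, span_insert]

theorem cons_mem_tuples {P : Submodule F V → Prop} (hP : Antitone P) {j : ℕ} (v : V)
    (f : Fin j → V) : (Fin.cons v f : Fin (j + 1) → V) ∈ tuples P (j + 1) ↔
      f ∈ tuples P j ∧ v ∈ extensions P (span F (Set.range f)) := by
  simp only [tuples, extensions, Set.mem_ofPred_eq, linearIndependent_finCons, span_range_cons]
  refine ⟨fun h => ⟨⟨h.1.1, hP le_sup_right h.2⟩, h.1.2, h.2⟩,
    fun h => ⟨⟨h.1.1, h.2.1⟩, h.2.2⟩⟩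

theorem finrank_span_of_mem_tuples {P : Submodule F V → Prop} {j : ℕ} {f : Fin j → V}
    (hf : f ∈ tuples P j) : finrank F (span F (Set.range f)) = j := by
  simpa using finrank_span_eq_card hf.1

theorem ncard_tuples_zero (P : Submodule F V → Prop) (h : P ⊥) : (tuples P 0).ncard = 1 := by
  have : tuples P 0 = {Fin.elim0} := by
    ext f
    have hf : f = Fin.elim0 := Subsingleton.elim _ _
    subst hf
    simpa [tuples, Set.range_eq_empty] using h
  rw [this, Set.ncard_singleton]

variable [Finite V]

open Classical in
theorem ncard_tuples_succ {P : Submodule F V → Prop} (hP : Antitone P) (j : ℕ) :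
    (tuples P (j + 1)).ncard =
      ∑ f ∈ (Set.toFinite (tuples P j)).toFinset,
        (extensions P (span F (Set.range f))).ncard := by
  have : Fintype V := Fintype.ofFinite V
  have e : tuples P (j + 1) ≃ Σ f : tuples P j, extensions P (span F (Set.range f.1)) :=
    { toFun := fun g =>
        ⟨⟨Fin.tail g.1, ((cons_mem_tuples hP (g.1 0) (Fin.tail g.1)).1
          (by rw [Fin.cons_self_tail]; exact g.2)).1⟩,
          g.1 0, ((cons_mem_tuples hP (g.1 0) (Fin.tail g.1)).1
          (by rw [Fin.cons_self_tail]; exact g.2)).2⟩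
      invFun := fun p => ⟨Fin.cons p.2.1 p.1.1, (cons_mem_tuples hP _ _).2 ⟨p.1.2, p.2.2⟩⟩
      left_inv := fun g => Subtype.ext (Fin.cons_self_tail g.1)
      right_inv := fun p => rfl }
  rw [← Nat.card_coe_set_eq, Nat.card_congr e, Nat.card_sigma]
  simp only [Nat.card_coe_set_eq]
  exact (Finset.sum_subtype _ (by simp) (fun f => (extensions P (span F (Set.range f))).ncard)).symm

theorem mul_ncard_tuples_le {P : Submodule F V → Prop} (hP : Antitone P) {j : ℕ} {c : ℝ}
    (h : ∀ U : Submodule F V, finrank F U = j → P U → c ≤ (extensions P U).ncard) :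
    c * (tuples P j).ncard ≤ (tuples P (j + 1)).ncard := by
  rw [ncard_tuples_succ hP, Nat.cast_sum, Set.ncard_eq_toFinset_card _ (Set.toFinite _), mul_comm,
    ← nsmul_eq_mul]
  refine Finset.card_nsmul_le_sum _ _ _ fun f hf => ?_
  rw [Set.Finite.mem_toFinset] at hf
  exact h _ (finrank_span_of_mem_tuples hf) hf.2

open Classical in
-- This serves a property `Q` that holds for most tuples: those with `Q` have few extensions, the
-- rare others may have more.
theorem ncard_tuples_le_add {P Q : Submodule F V → Prop} (hP : Antitone P)
    (hQP : ∀ U, Q U → P U) {j : ℕ} {c d : ℝ}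
    (hc : ∀ U : Submodule F V, finrank F U = j → Q U → (extensions P U).ncard ≤ c)
    (hd : ∀ U : Submodule F V, finrank F U = j → P U → ¬ Q U → (extensions P U).ncard ≤ d) :
    (tuples P (j + 1)).ncard ≤
      c * (tuples Q j).ncard + d * ((tuples P j).ncard - (tuples Q j).ncard : ℝ) := by
  set S := (Set.toFinite (tuples P j)).toFinset with hS
  set S' := (Set.toFinite (tuples Q j)).toFinset with hS'
  have hsub : S' ⊆ S := by
    intro f hf
    rw [hS', Set.Finite.mem_toFinset] at hf
    rw [hS, Set.Finite.mem_toFinset]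
    exact ⟨hf.1, hQP _ hf.2⟩
  have hcard : ((S \ S').card : ℝ) = S.card - S'.card := by
    rw [Finset.card_sdiff_of_subset hsub, Nat.cast_sub (Finset.card_le_card hsub)]
  rw [ncard_tuples_succ hP, Nat.cast_sum, Set.ncard_eq_toFinset_card _ (Set.toFinite (tuples P j)),
    Set.ncard_eq_toFinset_card _ (Set.toFinite (tuples Q j)), ← hS, ← hS', ← hcard,
    ← Finset.sum_sdiff hsub, add_comm, mul_comm c, mul_comm d, ← nsmul_eq_mul, ← nsmul_eq_mul]
  refine add_le_add (Finset.sum_le_card_nsmul _ _ _ fun f hf => ?_)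
    (Finset.sum_le_card_nsmul _ _ _ fun f hf => ?_)
  · rw [hS', Set.Finite.mem_toFinset] at hf
    exact hc _ (finrank_span_of_mem_tuples hf) hf.2
  · rw [Finset.mem_sdiff, hS', hS, Set.Finite.mem_toFinset, Set.Finite.mem_toFinset] at hf
    exact hd _ (finrank_span_of_mem_tuples hf.1) hf.1.2 fun h => hf.2 ⟨hf.1.1, h⟩

theorem ncard_tuples_le_mul {P : Submodule F V → Prop} (hP : Antitone P) {j : ℕ} {c : ℝ}
    (h : ∀ U : Submodule F V, finrank F U = j → P U → (extensions P U).ncard ≤ c) :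
    (tuples P (j + 1)).ncard ≤ c * (tuples P j).ncard := by
  simpa using ncard_tuples_le_add (Q := P) hP (fun _ => id) h
    (fun U _ h1 h2 => absurd h1 h2) (d := 0)

variable [Finite F]

/-- Every `k`-dimensional subspace has the same number of bases. -/
theorem ncard_tuples_eq_mul (P : Submodule F V → Prop) (k : ℕ) :
    (tuples P k).ncard = {C : Submodule F V | finrank F C = k ∧ P C}.ncard *
      ∏ i : Fin k, (Nat.card F ^ k - Nat.card F ^ (i : ℕ)) := by
  have : Module.Finite F V := Module.Finite.of_finite
  have hspan : ∀ (C : Submodule F V) (g : Fin k → C), finrank F C = k → LinearIndependent F g →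
      span F (Set.range fun i => (g i : V)) = C := by
    intro C g hC hg
    have h1 : LinearIndependent F (fun i => (g i : V)) := hg.map' C.subtype C.ker_subtype
    refine eq_of_le_of_finrank_eq ?_ ?_
    · rw [span_le]
      rintro _ ⟨i, rfl⟩
      exact (g i).2
    · rw [finrank_span_eq_card h1, Fintype.card_fin, hC]
  have e : (Σ C : {C : Submodule F V | finrank F C = k ∧ P C},
      {g : Fin k → C.1 // LinearIndependent F g}) ≃ tuples P k := by
    refine Equiv.ofBijective (fun p => ⟨fun i => (p.2.1 i : V),
      p.2.2.map' p.1.1.subtype p.1.1.ker_subtype, ?_⟩) ⟨?_, ?_⟩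
    · rw [hspan _ _ p.1.2.1 p.2.2]
      exact p.1.2.2
    · rintro ⟨⟨C, hC⟩, g, hg⟩ ⟨⟨D, hD⟩, g', hg'⟩ h
      have h' : (fun i => (g i : V)) = fun i => (g' i : V) := congrArg Subtype.val h
      have hCD : C = D := by
        rw [← hspan C g hC.1 hg, ← hspan D g' hD.1 hg', h']
      subst hCD
      have : g = g' := funext fun i => Subtype.ext (congrFun h' i)
      subst this
      rfl
    · rintro ⟨f, hf⟩
      refine ⟨⟨⟨span F (Set.range f), finrank_span_of_mem_tuples hf, hf.2⟩,
        fun i => ⟨f i, subset_span ⟨i, rfl⟩⟩, ?_⟩, rfl⟩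
      exact LinearIndependent.of_comp (span F (Set.range f)).subtype hf.1
  have := Fintype.ofFinite {C : Submodule F V | finrank F C = k ∧ P C}
  have := Fintype.ofFinite F
  rw [← Nat.card_coe_set_eq, ← Nat.card_congr e, Nat.card_sigma]
  have hC : ∀ C : {C : Submodule F V | finrank F C = k ∧ P C},
      Nat.card {g : Fin k → C.1 // LinearIndependent F g} =
        ∏ i : Fin k, (Nat.card F ^ k - Nat.card F ^ (i : ℕ)) := by
    intro C
    have := Fintype.ofFinite C.1
    rw [card_linearIndependent C.2.1.ge, C.2.1, Nat.card_eq_fintype_card]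
  rw [Finset.sum_congr rfl fun C _ => hC C, Finset.sum_const, Finset.card_univ,
    ← Nat.card_eq_fintype_card, Nat.card_coe_set_eq, smul_eq_mul]

/-- The number of bases of a `k`-dimensional space is a common nonzero factor and cancels. -/
theorem sigma_div_subspaceCount (B : LinearMap.BilinForm F V) (k : ℕ) :
    (sigma B k : ℝ) / subspaceCount F V k =
      (tuples (SelfOrthogonal B) k).ncard / (tuples (fun _ : Submodule F V => True) k).ncard := by
  have hne : ((∏ i : Fin k, (Nat.card F ^ k - Nat.card F ^ (i : ℕ)) : ℕ) : ℝ) ≠ 0 := by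
    rw [Nat.cast_ne_zero, Finset.prod_ne_zero_iff]
    intro i _
    have := Nat.pow_lt_pow_right (Finite.one_lt_card (α := F)) i.2
    omega
  rw [ncard_tuples_eq_mul, ncard_tuples_eq_mul, Nat.cast_mul, Nat.cast_mul,
    mul_div_mul_right _ _ hne]
  simp only [sigma, subspaceCount, and_true]

end Tuples

end BilinSpace
namespace BilinSpace

open Module Submodule

/-! ### The number of one-step extensions in each type. -/

section Extensions

variable {F : Type*} {V : Type*} [Field F] [AddCommGroup V] [Module F V]
  {B : LinearMap.BilinForm F V}

theorem antitone_selfOrthogonal : Antitone (SelfOrthogonal B) := fun _ _ h hD => hD.mono h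

theorem extensions_selfOrthogonal (hs : B.IsSymm) {U : Submodule F V} (hU : SelfOrthogonal B U) :
    extensions (SelfOrthogonal B) U = isotropicPerp B U \ U := by
  ext v
  simp only [extensions, isotropicPerp, Set.mem_ofPred_eq, Set.mem_sdiff, SetLike.mem_coe,
    selfOrthogonal_span_singleton_sup_iff hs hU]
  tauto

/-- `U` is self-orthogonal and `U^⊥` contains an anisotropic vector. -/
def SelfOrthogonalAniso (hs : B.IsSymm) (h2 : (2 : F) = 0) (U : Submodule F V) : Prop :=
  SelfOrthogonal B U ∧ ¬ B.orthogonal U ≤ isotropicSubmodule B hs h2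

theorem antitone_selfOrthogonalAniso (hs : B.IsSymm) (h2 : (2 : F) = 0) :
    Antitone (SelfOrthogonalAniso hs h2) :=
  fun _ _ h hD => ⟨hD.1.mono h, fun hle =>
    hD.2 ((LinearMap.BilinForm.orthogonal_le h).trans hle)⟩

variable [FiniteDimensional F V]

theorem ncard_isotropicPerp_of_isAlt (ha : B.IsAlt) (U : Submodule F V) :
    (isotropicPerp B U).ncard = Nat.card F ^ finrank F (B.orthogonal U) := by
  rw [← ncard_submodule]
  congr 1
  ext v
  simp [isotropicPerp, ha v]

theorem ncard_isotropicPerp_eq_inf (hs : B.IsSymm) (h2 : (2 : F) = 0) (U : Submodule F V) :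
    (isotropicPerp B U).ncard =
    Nat.card F ^ finrank F (B.orthogonal U ⊓ isotropicSubmodule B hs h2 : Submodule F V) := by
  rw [← ncard_submodule]
  rfl

variable [Finite F]

theorem ncard_extensions_true (U : Submodule F V) :
    (extensions (fun _ => True) U).ncard + Nat.card F ^ finrank F U =
      Nat.card F ^ finrank F V := by
  have := finite_of_finiteDimensional F V
  have h : extensions (fun _ => True) U = (U : Set V)ᶜ := by
    ext v
    simp [extensions]
  rw [h, ← ncard_submodule, add_comm, Set.ncard_add_ncard_compl,
    Module.natCard_eq_pow_finrank (K := F)]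

theorem ncard_extensions_add (hs : B.IsSymm) {U : Submodule F V} (hU : SelfOrthogonal B U) :
    (extensions (SelfOrthogonal B) U).ncard + Nat.card F ^ finrank F U =
      (isotropicPerp B U).ncard := by
  have := finite_of_finiteDimensional F V
  rw [extensions_selfOrthogonal hs hU, ← ncard_submodule]
  exact Set.ncard_sdiff_add_ncard_of_subset fun u hu => ⟨hU hu, selfOrthogonal_iff.1 hU u hu u hu⟩

theorem ncard_isotropicPerp_le (U : Submodule F V) :
    (isotropicPerp B U).ncard ≤ Nat.card F ^ finrank F (B.orthogonal U) := by
  have := finite_of_finiteDimensional F V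
  rw [← ncard_submodule]
  exact Set.ncard_le_ncard fun v hv => hv.1

/-- In the identity for `U' = span F {e} ⊔ U` the main term is `q ^ (n - j)`, where `j = dim U`.
Since `dim U' < n / 2`, `U'^⊥` has an anisotropic vector, so its isotropic vectors only contribute
to the error. -/
theorem mul_ncard_extensions_bounds (hs : B.IsSymm) (hn : B.Nondegenerate) (h2 : (2 : F) ≠ 0)
    {U : Submodule F V} (hU : SelfOrthogonal B U) (hw : finrank F U < wittIndex B)
    (hU2 : 2 * (finrank F U + 1) < finrank F V) :
    Nat.card F ^ (finrank F V - finrank F U) ≤ Nat.card F *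
        (extensions (SelfOrthogonal B) U).ncard + 2 * Nat.card F ^ (finrank F V - finrank F U - 1) ∧
      Nat.card F * (extensions (SelfOrthogonal B) U).ncard ≤
        Nat.card F ^ (finrank F V - finrank F U) +
          2 * Nat.card F ^ (finrank F V - finrank F U - 1) := by
  obtain ⟨e, he, heU, hee⟩ := exists_isotropic_of_finrank_lt_wittIndex hs hn hw
  have h1 := ncard_isotropicPerp_eq hs hn h2 he heU hee
  have hr := finrank_span_singleton_sup heU
  obtain ⟨w, hw1, hw2⟩ := exists_apply_self_ne_zero hs hn h2
    (U := span F {e} ⊔ U) (by rw [hr]; exact hU2)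
  have h3 := card_mul_ncard_zeros_le _ hw1 hw2
  have h4 := finrank_add_finrank_orthogonal_eq hn (span F {e} ⊔ U)
  have h5 : finrank F (B.orthogonal (span F {e} ⊔ U)) = finrank F V - finrank F U - 1 := by omega
  rw [h5] at h3
  change _ * (isotropicPerp B (span F {e} ⊔ U)).ncard ≤ _ at h3
  have h6 := ncard_extensions_add hs hU
  rw [← h6, mul_add, ← pow_succ'] at h1
  -- The vectors of `U` itself are removed. This and the term `q ^ (n - j - 1)` of the identity make
  -- up the constant `2` in the lower bound.
  have h7 : Nat.card F ^ (finrank F U + 1) ≤ Nat.card F ^ (finrank F V - finrank F U - 1) :=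
    Nat.pow_le_pow_right Nat.card_pos (by omega)
  omega

/-- Here `U' = span F {e} ⊔ U` equals its own orthogonal complement and is entirely isotropic, so
the identity becomes an exact count. -/
theorem ncard_extensions_of_two_mul_eq (hs : B.IsSymm) (hn : B.Nondegenerate)
    (h2 : (2 : F) ≠ 0) {U : Submodule F V} (hU : SelfOrthogonal B U)
    (hw : finrank F U < wittIndex B) (hU2 : 2 * (finrank F U + 1) = finrank F V) :
    (extensions (SelfOrthogonal B) U).ncard + 2 * Nat.card F ^ finrank F U =
      2 * Nat.card F ^ (finrank F U + 1) := by
  obtain ⟨e, he, heU, hee⟩ := exists_isotropic_of_finrank_lt_wittIndex hs hn hw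
  have h1 := ncard_isotropicPerp_eq hs hn h2 he heU hee
  have hr := finrank_span_singleton_sup heU
  have hU' := (selfOrthogonal_span_singleton_sup_iff hs hU e).2 ⟨he, hee⟩
  have h3 : isotropicPerp B (span F {e} ⊔ U) = (span F {e} ⊔ U : Submodule F V) := by
    ext v
    simp only [isotropicPerp, Set.mem_ofPred_eq, SetLike.mem_coe,
      orthogonal_eq_self hn hU' (by rw [hr, hU2])]
    exact ⟨fun h => h.1, fun h => ⟨h, selfOrthogonal_iff.1 hU' v h v h⟩⟩
  have h6 := ncard_extensions_add hs hU
  rw [h3, ncard_submodule, hr, ← h6, ← hU2,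
    show 2 * (finrank F U + 1) - finrank F U - 1 = finrank F U + 1 by omega,
    show 2 * (finrank F U + 1) - finrank F U = finrank F U + 1 + 1 by omega] at h1
  refine Nat.eq_of_mul_eq_mul_left (Nat.card_pos (α := F)) ?_
  simp only [pow_succ] at h1 ⊢
  linarith

theorem ncard_extensions_of_isAlt (hs : B.IsSymm) (hn : B.Nondegenerate) (ha : B.IsAlt)
    {U : Submodule F V} (hU : SelfOrthogonal B U) :
    (extensions (SelfOrthogonal B) U).ncard + Nat.card F ^ finrank F U =
      Nat.card F ^ (finrank F V - finrank F U) := by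
  rw [ncard_extensions_add hs hU, ncard_isotropicPerp_of_isAlt ha,
    LinearMap.BilinForm.finrank_orthogonal hn]

theorem ncard_isotropicPerp_of_aniso (hs : B.IsSymm) (h2 : (2 : F) = 0) 
    (hn : B.Nondegenerate) {U : Submodule F V}
    (hU : SelfOrthogonalAniso hs h2 U) :
    (isotropicPerp B U).ncard = Nat.card F ^ (finrank F V - finrank F U - 1) := by
  have h := finrank_inf_isotropicSubmodule hU.2
  have h1 := finrank_add_finrank_orthogonal_eq hn U
  rw [ncard_isotropicPerp_eq_inf hs h2]
  congr 1
  omega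

theorem le_ncard_isotropicPerp (hs : B.IsSymm) (h2 : (2 : F) = 0) 
    (hn : B.Nondegenerate) (U : Submodule F V) :
    Nat.card F ^ (finrank F V - finrank F U - 1) ≤ (isotropicPerp B U).ncard := by
  have h1 := finrank_add_finrank_orthogonal_eq hn U
  rw [ncard_isotropicPerp_eq_inf hs h2]
  refine Nat.pow_le_pow_right Nat.card_pos ?_
  by_cases h : B.orthogonal U ≤ isotropicSubmodule B hs h2
  · rw [inf_eq_left.2 h]
    omega
  · have h := finrank_inf_isotropicSubmodule h
    omega

/-- Let `K` be the space of isotropic vectors in `U^⊥`. If adjoining `v ∈ K \ U` destroys the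
property, then `(span F {v} ⊔ U)^⊥` equals `K` by dimension, so `v ∈ K^⊥`. As `U ≤ K^⊥` too, all bad
vectors lie in `K^⊥`, of dimension `dim U + 1`. -/
theorem le_ncard_extensions_aniso (hs : B.IsSymm) (h2 : (2 : F) = 0) 
    (hn : B.Nondegenerate) {U : Submodule F V}
    (hU : SelfOrthogonalAniso hs h2 U) :
    Nat.card F ^ (finrank F V - finrank F U - 1) ≤
      (extensions (SelfOrthogonalAniso hs h2) U).ncard + Nat.card F ^ (finrank F U + 1) := by
  have := finite_of_finiteDimensional F V
  set K := B.orthogonal U ⊓ isotropicSubmodule B hs h2 with hK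
  have h0 : finrank F K + 1 = _ := finrank_inf_isotropicSubmodule hU.2
  have h1 := finrank_add_finrank_orthogonal_eq hn U
  have h3 := finrank_add_finrank_orthogonal_eq hn K
  rw [show finrank F V - finrank F U - 1 = finrank F K by omega,
    show finrank F U + 1 = finrank F (B.orthogonal K) by omega, ← ncard_submodule,
    ← ncard_submodule, add_comm]
  have hsub : (K : Set V) ⊆ (B.orthogonal K : Set V) ∪
      extensions (SelfOrthogonalAniso hs h2) U := by
    intro v hv
    by_cases hvK : v ∈ B.orthogonal K
    · exact Or.inl hvK
    right
    have hvU : v ∉ U := by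
      intro h
      refine hvK fun y hy => ?_
      have h4 : B v y = 0 := hy.1 v h
      rw [hs.eq]
      exact h4
    refine ⟨hvU, (selfOrthogonal_span_singleton_sup_iff hs hU.1 v).2 hv, fun hle => hvK ?_⟩
    have h4 := finrank_add_finrank_orthogonal_eq hn (span F {v} ⊔ U)
    rw [finrank_span_singleton_sup hvU] at h4
    have h5 : B.orthogonal (span F {v} ⊔ U) = K :=
      eq_of_le_of_finrank_eq
        (le_inf (LinearMap.BilinForm.orthogonal_le le_sup_right) hle) (by omega)
    rw [← h5]
    intro y hy
    rw [hs.eq]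
    exact (mem_orthogonal_span_singleton_sup.1 hy).1
  exact (Set.ncard_le_ncard hsub).trans (Set.ncard_union_le _ _)

end Extensions

end BilinSpace

namespace BilinSpace

open Module Submodule Filter Topology

/-! ### Products of the step bounds, exponent sums and the limit. -/

section Real

theorem prod_lower_bound {N : ℕ → ℝ} {q : ℝ} (hq : 2 ≤ q) {e : ℕ → ℕ} (h0 : N 0 = 1) (k : ℕ)
    (h : ∀ j < k, q ^ e j * (1 - 2 / q) * N j ≤ N (j + 1)) :
    q ^ (∑ j ∈ Finset.range k, e j) * (1 - 2 / q) ^ k ≤ N k := by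
  have hq0 : 0 < q := by linarith
  have h1 : 0 ≤ 1 - 2 / q := by
    rw [sub_nonneg, div_le_one hq0]
    exact hq
  induction k with
  | zero => simp [h0]
  | succ k ih =>
    have ih1 := ih fun j hj => h j (by omega)
    rw [Finset.sum_range_succ]
    calc _ = q ^ e k * (1 - 2 / q) *
          (q ^ (∑ j ∈ Finset.range k, e j) * (1 - 2 / q) ^ k) := by ring
      _ ≤ q ^ e k * (1 - 2 / q) * N k := by gcongr
      _ ≤ _ := h k (by omega)

theorem prod_upper_bound {N : ℕ → ℝ} {q : ℝ} (hq : 2 ≤ q) {e : ℕ → ℕ} (h0 : N 0 = 1) (k : ℕ)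
    (h : ∀ j < k, N (j + 1) ≤ q ^ e j * (1 + 2 / q) * N j) :
    N k ≤ q ^ (∑ j ∈ Finset.range k, e j) * (1 + 2 / q) ^ k := by
  have hq0 : 0 < q := by linarith
  induction k with
  | zero => simp [h0]
  | succ k ih =>
    have ih1 := ih fun j hj => h j (by omega)
    rw [Finset.sum_range_succ]
    calc _ ≤ q ^ e k * (1 + 2 / q) * N k := h k (by omega)
      _ ≤ q ^ e k * (1 + 2 / q) *
          (q ^ (∑ j ∈ Finset.range k, e j) * (1 + 2 / q) ^ k) := by gcongr
      _ = _ := by ring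

theorem prod_bounds {N : ℕ → ℝ} {q : ℝ} (hq : 2 ≤ q) {e : ℕ → ℕ} (h0 : N 0 = 1) (k : ℕ)
    (h : ∀ j < k, q ^ e j * (1 - 2 / q) * N j ≤ N (j + 1) ∧
      N (j + 1) ≤ q ^ e j * (1 + 2 / q) * N j) :
    q ^ (∑ j ∈ Finset.range k, e j) * (1 - 2 / q) ^ k ≤ N k ∧
      N k ≤ q ^ (∑ j ∈ Finset.range k, e j) * (1 + 2 / q) ^ k :=
  ⟨prod_lower_bound hq h0 k fun j hj => (h j hj).1,
    prod_upper_bound hq h0 k fun j hj => (h j hj).2⟩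

theorem tendsto_bounds_ratio (k : ℕ) :
    Tendsto (fun q : ℕ => (1 + 2 / (q : ℝ)) ^ k / (1 - 2 / (q : ℝ)) ^ k) atTop (𝓝 1) := by
  have h := tendsto_const_div_atTop_nhds_zero_nat (2 : ℝ)
  have h1 := ((tendsto_const_nhds (x := (1 : ℝ))).add h).pow k
  have h2 := ((tendsto_const_nhds (x := (1 : ℝ))).sub h).pow k
  have h3 := h1.div h2 (by simp)
  simp only [add_zero, sub_zero, one_pow, div_one] at h3
  exact h3

theorem sum_range_sub_sub_one {n k : ℕ} (h : k ≤ n) :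
    ∑ j ∈ Finset.range k, (n - j - 1) + (k + 1).choose 2 = n * k := by
  induction k with
  | zero => simp
  | succ k ih =>
    have := ih (by omega)
    have hc : (k + 1 + 1).choose 2 = (k + 1).choose 1 + (k + 1).choose 2 := rfl
    rw [Finset.sum_range_succ, hc, Nat.choose_one_right, mul_add, ← this]
    omega

theorem sum_range_sub {n k : ℕ} (h : k ≤ n) :
    ∑ j ∈ Finset.range k, (n - j) + (k + 1).choose 2 = n * k + k := by
  have h1 : ∑ j ∈ Finset.range k, (n - j) = ∑ j ∈ Finset.range k, ((n - j - 1) + 1) := by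
    refine Finset.sum_congr rfl fun j hj => ?_
    have := Finset.mem_range.1 hj
    omega
  rw [← sum_range_sub_sub_one h, h1, Finset.sum_add_distrib, Finset.sum_const, Finset.card_range,
    smul_eq_mul, mul_one]
  omega

end Real

/-- Uniform two-sided bounds on the number of self-orthogonal `k`-tuples give the asymptotics of
the proportion. -/
theorem proportionAsymp_of_bounds (T : SpaceType) {n k : ℕ} (hkn : 2 * k ≤ n) {g : ℝ → ℝ} {c : ℝ}
    (hc : 0 < c) (e : ℕ) (hg : ∀ q : ℝ, 0 < q → g q * q ^ (n * k) = c * q ^ e)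
    (h : ∀ (F : Type u) [Field F] [Finite F] (V : Type v) [AddCommGroup V] [Module F V]
      [FiniteDimensional F V] (B : LinearMap.BilinForm F V),
      finrank F V = n → B.IsSymm → B.Nondegenerate → IsOfType B T → k ≤ wittIndex B →
      (c * (Nat.card F : ℝ) ^ e * (1 - 2 / (Nat.card F : ℝ)) ^ k ≤
          (tuples (SelfOrthogonal B) k).ncard ∧
        (tuples (SelfOrthogonal B) k).ncard ≤
          c * (Nat.card F : ℝ) ^ e * (1 + 2 / (Nat.card F : ℝ)) ^ k)) :
    ProportionAsymp.{u, v} T n k g := by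
  intro ε hε
  have ht := tendsto_bounds_ratio k
  have ht' := ht.inv₀ one_ne_zero
  rw [inv_one] at ht'
  have ev := (ht.eventually (gt_mem_nhds (show (1 : ℝ) < 1 + ε by linarith))).and
    ((ht'.eventually (lt_mem_nhds (show (1 : ℝ) - ε < 1 by linarith))).and
      (eventually_ge_atTop 3))
  obtain ⟨q₀, hq₀⟩ := eventually_atTop.1 ev
  refine ⟨q₀, fun F _ _ V _ _ _ B hq hV hs hn hT hw => ?_⟩
  obtain ⟨u1, u2, u3⟩ := hq₀ _ hq
  obtain ⟨b1, b2⟩ := h F V B hV hs hn hT hw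
  have := finite_of_finiteDimensional F V
  rw [sigma_div_subspaceCount]
  set q : ℝ := (Nat.card F : ℝ) with hqdef
  have hq3 : (3 : ℝ) ≤ q := by rw [hqdef]; exact_mod_cast u3
  have hq0 : 0 < q := by linarith
  have hpos : 0 < 1 - 2 / q := by
    rw [sub_pos, div_lt_one hq0]
    linarith
  have hP : Antitone (fun _ : Submodule F V => True) := fun _ _ _ h => h
  have hext : ∀ j < k, ∀ U : Submodule F V, finrank F U = j →
      q ^ n * (1 - 2 / q) ≤ (extensions (fun _ => True) U).ncard ∧
        (extensions (fun _ => True) U).ncard ≤ q ^ n * (1 + 2 / q) := by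
    intro j hj U hU
    have h1 := ncard_extensions_true U
    rw [hV, hU] at h1
    have h2 : ((extensions (fun _ => True) U).ncard : ℝ) + q ^ j = q ^ n := by
      rw [hqdef]
      exact_mod_cast h1
    have h3 : q ^ j ≤ q ^ n * (2 / q) := by
      have h4 : q ^ n = q ^ (n - 1) * q := by rw [← pow_succ]; congr 1; omega
      rw [h4]
      have h5 : q ^ j ≤ q ^ (n - 1) := pow_le_pow_right₀ (by linarith) (by omega)
      have h6 : 0 ≤ q ^ j := by positivity
      field_simp
      linarith
    have h7 : 0 < q ^ j := by positivity
    constructor <;> linarith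
  have hM := prod_bounds (N := fun j => ((tuples (fun _ : Submodule F V => True) j).ncard : ℝ))
    (q := q) (by linarith) (e := fun _ => n) (by simp [ncard_tuples_zero]) k (fun j hj =>
      ⟨mul_ncard_tuples_le hP fun U hU _ => (hext j hj U hU).1,
        ncard_tuples_le_mul hP fun U hU _ => (hext j hj U hU).2⟩)
  simp only [Finset.sum_const, Finset.card_range, smul_eq_mul] at hM
  obtain ⟨m1, m2⟩ := hM
  rw [mul_comm k n] at m1 m2
  set N : ℝ := ((tuples (SelfOrthogonal B) k).ncard : ℝ)
  set M : ℝ := ((tuples (fun _ : Submodule F V => True) k).ncard : ℝ)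
  have hg' := hg q hq0
  have hgq : g q = c * q ^ e / q ^ (n * k) := by
    rw [eq_div_iff (by positivity), hg']
  have hL : 0 < (1 - 2 / q) ^ k := by positivity
  have hR : 0 < (1 + 2 / q) ^ k := by positivity
  set L := (1 - 2 / q) ^ k
  set R := (1 + 2 / q) ^ k
  have hD : 0 < q ^ (n * k) := by positivity
  have hG : 0 < c * q ^ e := by positivity
  have hMpos : 0 < M := lt_of_lt_of_le (by positivity) m1
  -- Both normalized counts lie in `[L, R]`, so their quotient lies in `[L / R, R / L]`, and both
  -- ends tend to `1`.
  have hx : N / M / g q = (N / (c * q ^ e)) / (M / q ^ (n * k)) := by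
    rw [hgq]
    field_simp
  have n1 : L ≤ N / (c * q ^ e) := by rw [le_div_iff₀ hG]; linarith
  have n2 : N / (c * q ^ e) ≤ R := by rw [div_le_iff₀ hG]; linarith
  have y1 : L ≤ M / q ^ (n * k) := by rw [le_div_iff₀ hD]; linarith
  have y2 : M / q ^ (n * k) ≤ R := by rw [div_le_iff₀ hD]; linarith
  rw [inv_div] at u2
  have z1 : L / R ≤ N / M / g q := by
    rw [hx]
    exact div_le_div₀ (hL.le.trans n1) n1 (hL.trans_le y1) y2
  have z2 : N / M / g q ≤ R / L := by
    rw [hx]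
    exact div_le_div₀ hR.le n2 hL y1
  rw [abs_lt]
  constructor <;> linarith

theorem ncard_tuples_selfOrthogonal_zero {F : Type*} {V : Type*} [Field F] [AddCommGroup V]
    [Module F V] {B : LinearMap.BilinForm F V} :
    ((tuples (SelfOrthogonal B) 0).ncard : ℝ) = 1 := by
  rw [ncard_tuples_zero _ (show SelfOrthogonal B ⊥ from bot_le), Nat.cast_one]

/-! ### Bounds on the number of self-orthogonal tuples, type by type. -/

section Bounds

variable {F : Type*} {V : Type*} [Field F] [Finite F] [AddCommGroup V] [Module F V]
  [FiniteDimensional F V] {B : LinearMap.BilinForm F V}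

theorem two_le_card_real (F : Type*) [Field F] [Finite F] : (2 : ℝ) ≤ Nat.card F := by
  exact_mod_cast Finite.one_lt_card (α := F)

/-- Odd characteristic, away from the maximal dimension of hyperbolic spaces. -/
theorem odd_bounds (hs : B.IsSymm) (hn : B.Nondegenerate) (h2 : (2 : F) ≠ 0) {k : ℕ}
    (hk : k ≤ wittIndex B) (hkn : 2 * k < finrank F V) :
    (Nat.card F : ℝ) ^ (∑ j ∈ Finset.range k, (finrank F V - j - 1)) *
        (1 - 2 / (Nat.card F : ℝ)) ^ k ≤ (tuples (SelfOrthogonal B) k).ncard ∧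
      (tuples (SelfOrthogonal B) k).ncard ≤
        (Nat.card F : ℝ) ^ (∑ j ∈ Finset.range k, (finrank F V - j - 1)) *
          (1 + 2 / (Nat.card F : ℝ)) ^ k := by
  have := finite_of_finiteDimensional F V
  have hq := two_le_card_real F
  have hext : ∀ j < k, ∀ U : Submodule F V, finrank F U = j → SelfOrthogonal B U →
      (Nat.card F : ℝ) ^ (finrank F V - j - 1) * (1 - 2 / (Nat.card F : ℝ)) ≤
        (extensions (SelfOrthogonal B) U).ncard ∧
      (extensions (SelfOrthogonal B) U).ncard ≤
        (Nat.card F : ℝ) ^ (finrank F V - j - 1) * (1 + 2 / (Nat.card F : ℝ)) := by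
    intro j hj U hU hUs
    obtain ⟨h1, h3⟩ := mul_ncard_extensions_bounds hs hn h2 hUs (by omega) (by omega)
    rw [hU, show finrank F V - j = finrank F V - j - 1 + 1 by omega, pow_succ',
      Nat.add_sub_cancel] at h1 h3
    rify at h1 h3
    set q : ℝ := (Nat.card F : ℝ)
    have hq0 : 0 < q := by linarith
    constructor
    · refine le_of_mul_le_mul_left ?_ hq0
      field_simp
      linarith
    · refine le_of_mul_le_mul_left ?_ hq0
      field_simp
      linarith
  exact prod_bounds (N := fun j => ((tuples (SelfOrthogonal B) j).ncard : ℝ)) hq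
    (e := fun j => finrank F V - j - 1) ncard_tuples_selfOrthogonal_zero k fun j hj =>
      ⟨mul_ncard_tuples_le antitone_selfOrthogonal fun U hU hs => (hext j hj U hU hs).1,
        ncard_tuples_le_mul antitone_selfOrthogonal fun U hU hs => (hext j hj U hU hs).2⟩

/-- All steps but the last stay below half the dimension and fall under `odd_bounds`; the last has
exactly `2 * q ^ k * (1 - 1 / q)` choices. -/
theorem hyperbolic_bounds (hs : B.IsSymm) (hn : B.Nondegenerate) (h2 : (2 : F) ≠ 0) {k : ℕ}
    (hk1 : 1 ≤ k) (hk : k ≤ wittIndex B) (hkn : 2 * k = finrank F V) :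
    2 * (Nat.card F : ℝ) ^ (∑ j ∈ Finset.range k, (finrank F V - j - 1)) *
        (1 - 2 / (Nat.card F : ℝ)) ^ k ≤ (tuples (SelfOrthogonal B) k).ncard ∧
      (tuples (SelfOrthogonal B) k).ncard ≤
        2 * (Nat.card F : ℝ) ^ (∑ j ∈ Finset.range k, (finrank F V - j - 1)) *
          (1 + 2 / (Nat.card F : ℝ)) ^ k := by
  have := finite_of_finiteDimensional F V
  have hq := two_le_card_real F
  obtain ⟨j, rfl⟩ : ∃ j, k = j + 1 := ⟨k - 1, by omega⟩
  obtain ⟨b1, b2⟩ := odd_bounds hs hn h2 (k := j) (by omega) (by omega)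
  have hext : ∀ U : Submodule F V, finrank F U = j → SelfOrthogonal B U →
      ((extensions (SelfOrthogonal B) U).ncard : ℝ) =
        2 * (Nat.card F : ℝ) ^ (j + 1) * (1 - 1 / (Nat.card F : ℝ)) := by
    intro U hU hUs
    have h1 := ncard_extensions_of_two_mul_eq hs hn h2 hUs (by omega) (by omega)
    rw [hU] at h1
    rify at h1
    field_simp
    rw [pow_succ] at h1 ⊢
    linear_combination (Nat.card F : ℝ) * h1
  have s1 := mul_ncard_tuples_le antitone_selfOrthogonal fun U hU hs => (hext U hU hs).ge
  have s2 := ncard_tuples_le_mul antitone_selfOrthogonal fun U hU hs => (hext U hU hs).le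
  rw [Finset.sum_range_succ, show finrank F V - j - 1 = j + 1 by omega]
  set q : ℝ := (Nat.card F : ℝ)
  set S := ∑ j ∈ Finset.range j, (finrank F V - j - 1)
  have hq0 : 0 < q := by linarith
  have h1 : 0 ≤ 1 - 2 / q := by
    rw [sub_nonneg, div_le_one hq0]
    exact hq
  have h3 : 1 - 2 / q ≤ 1 - 1 / q := by gcongr; norm_num
  have h4 : 1 - 1 / q ≤ 1 + 2 / q := by
    have : 0 < 1 / q := by positivity
    have : 0 < 2 / q := by positivity
    linarith
  have h5 : 0 ≤ 1 - 1 / q := h1.trans h3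
  constructor
  · calc _ = 2 * q ^ (j + 1) * (1 - 2 / q) * (q ^ S * (1 - 2 / q) ^ j) := by ring
      _ ≤ 2 * q ^ (j + 1) * (1 - 1 / q) * (tuples (SelfOrthogonal B) j).ncard := by gcongr
      _ ≤ _ := s1
  · calc _ ≤ 2 * q ^ (j + 1) * (1 - 1 / q) * (tuples (SelfOrthogonal B) j).ncard := s2
      _ ≤ 2 * q ^ (j + 1) * (1 + 2 / q) * (q ^ S * (1 + 2 / q) ^ j) := by gcongr
      _ = _ := by ring

theorem alternating_bounds (hs : B.IsSymm) (hn : B.Nondegenerate) (ha : B.IsAlt) {k : ℕ}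
    (hkn : 2 * k ≤ finrank F V) :
    (Nat.card F : ℝ) ^ (∑ j ∈ Finset.range k, (finrank F V - j)) *
        (1 - 2 / (Nat.card F : ℝ)) ^ k ≤ (tuples (SelfOrthogonal B) k).ncard ∧
      (tuples (SelfOrthogonal B) k).ncard ≤
        (Nat.card F : ℝ) ^ (∑ j ∈ Finset.range k, (finrank F V - j)) *
          (1 + 2 / (Nat.card F : ℝ)) ^ k := by
  have := finite_of_finiteDimensional F V
  have hq := two_le_card_real F
  have hext : ∀ j < k, ∀ U : Submodule F V, finrank F U = j → SelfOrthogonal B U →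
      (Nat.card F : ℝ) ^ (finrank F V - j) * (1 - 2 / (Nat.card F : ℝ)) ≤
        (extensions (SelfOrthogonal B) U).ncard ∧
      (extensions (SelfOrthogonal B) U).ncard ≤
        (Nat.card F : ℝ) ^ (finrank F V - j) * (1 + 2 / (Nat.card F : ℝ)) := by
    intro j hj U hU hUs
    have h1 := ncard_extensions_of_isAlt hs hn ha hUs
    rw [hU, show finrank F V - j = finrank F V - j - 1 + 1 by omega, pow_succ] at h1
    rw [show finrank F V - j = finrank F V - j - 1 + 1 by omega, pow_succ]
    rify at h1
    set q : ℝ := (Nat.card F : ℝ)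
    have hq0 : 0 < q := by linarith
    have h3 : q ^ j ≤ q ^ (finrank F V - j - 1) := pow_le_pow_right₀ (by linarith) (by omega)
    have h4 : 0 < q ^ j := by positivity
    constructor <;>
    · field_simp
      linarith
  exact prod_bounds (N := fun j => ((tuples (SelfOrthogonal B) j).ncard : ℝ)) hq
    (e := fun j => finrank F V - j) ncard_tuples_selfOrthogonal_zero k fun j hj =>
      ⟨mul_ncard_tuples_le antitone_selfOrthogonal fun U hU hs => (hext j hj U hU hs).1,
        ncard_tuples_le_mul antitone_selfOrthogonal fun U hU hs => (hext j hj U hU hs).2⟩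

theorem ncard_extensions_aniso_le (hs : B.IsSymm) (h2 : (2 : F) = 0) (U : Submodule F V) :
    (extensions (SelfOrthogonalAniso hs h2) U).ncard ≤ (extensions (SelfOrthogonal B) U).ncard := by
  have := finite_of_finiteDimensional F V
  exact Set.ncard_le_ncard fun v hv => ⟨hv.1, hv.2.1⟩

theorem ncard_extensions_le_of_aniso (hs : B.IsSymm) (h2 : (2 : F) = 0) (hn : B.Nondegenerate)
    {j : ℕ} {U : Submodule F V} (hU : finrank F U = j) (hUs : SelfOrthogonalAniso hs h2 U) :
    ((extensions (SelfOrthogonal B) U).ncard : ℝ) ≤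
      (Nat.card F : ℝ) ^ (finrank F V - j - 1) := by
  have h1 := ncard_extensions_add hs hUs.1
  rw [ncard_isotropicPerp_of_aniso hs h2 hn hUs, hU] at h1
  exact_mod_cast le_of_add_le_left h1.le

theorem ncard_tuples_succ_le_aniso (hs : B.IsSymm) (h2 : (2 : F) = 0) (hn : B.Nondegenerate)
    {j : ℕ} (hj : j < finrank F V) :
    ((tuples (SelfOrthogonal B) (j + 1)).ncard : ℝ) ≤
      (Nat.card F : ℝ) ^ (finrank F V - j - 1) * (tuples (SelfOrthogonalAniso hs h2) j).ncard +
        (Nat.card F : ℝ) ^ (finrank F V - j - 1 + 1) * ((tuples (SelfOrthogonal B) j).ncard -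
          (tuples (SelfOrthogonalAniso hs h2) j).ncard : ℝ) := by
  have := finite_of_finiteDimensional F V
  refine ncard_tuples_le_add (P := SelfOrthogonal B) (Q := SelfOrthogonalAniso hs h2)
    antitone_selfOrthogonal (fun U h => h.1)
    (fun U hU hUs => ncard_extensions_le_of_aniso hs h2 hn hU hUs) fun U hU hUs _ => ?_
  have h1 := ncard_extensions_add hs hUs
  have h3 := ncard_isotropicPerp_le (B := B) U
  rw [LinearMap.BilinForm.finrank_orthogonal hn, hU] at h3
  rw [show finrank F V - j - 1 + 1 = finrank F V - j by omega]
  exact_mod_cast (le_of_add_le_left h1.le).trans h3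

/-- Self-orthogonal tuples whose orthogonal complement consists of isotropic vectors are rare. -/
theorem aniso_bounds (hs : B.IsSymm) (hn : B.Nondegenerate) (h2 : (2 : F) = 0) (ha : ¬ B.IsAlt)
    (j : ℕ) (hj : 2 * j ≤ finrank F V) :
    ((tuples (SelfOrthogonalAniso hs h2) j).ncard : ℝ) ≤
        (Nat.card F : ℝ) ^ (∑ i ∈ Finset.range j, (finrank F V - i - 1)) ∧
      (Nat.card F : ℝ) ^ finrank F V * ((tuples (SelfOrthogonal B) j).ncard -
          (tuples (SelfOrthogonalAniso hs h2) j).ncard : ℝ) ≤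
        2 * (Nat.card F : ℝ) ^ (2 * j) *
          (Nat.card F : ℝ) ^ (∑ i ∈ Finset.range j, (finrank F V - i - 1)) := by
  have := finite_of_finiteDimensional F V
  have hq := two_le_card_real F
  induction j with
  | zero =>
    have h0 : SelfOrthogonalAniso hs h2 (⊥ : Submodule F V) := by
      refine ⟨bot_le, fun hle => ha fun v => ?_⟩
      rw [LinearMap.BilinForm.orthogonal_bot] at hle
      exact hle (mem_top (x := v))
    rw [ncard_tuples_zero _ h0, ncard_tuples_zero _ h0.1]
    simp
  | succ j ih =>
    obtain ⟨ih1, ih2⟩ := ih (by omega)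
    have hU3 : ∀ U : Submodule F V, finrank F U = j → SelfOrthogonalAniso hs h2 U →
        (Nat.card F : ℝ) ^ (finrank F V - j - 1) - (Nat.card F : ℝ) ^ (j + 1) ≤
          (extensions (SelfOrthogonalAniso hs h2) U).ncard := by
      intro U hU hUs
      have h1 := le_ncard_extensions_aniso hs h2 hn hUs
      rw [hU] at h1
      rify at h1
      linarith
    have s1 := ncard_tuples_le_mul (j := j) (antitone_selfOrthogonalAniso hs h2) fun U hU hUs =>
      (Nat.cast_le.2 (ncard_extensions_aniso_le hs h2 U)).trans
        (ncard_extensions_le_of_aniso hs h2 hn hU hUs)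
    have s2 := ncard_tuples_succ_le_aniso hs h2 hn (j := j) (by omega)
    have s3 := mul_ncard_tuples_le (antitone_selfOrthogonalAniso hs h2) hU3
    rw [Finset.sum_range_succ]
    have hnj : finrank F V = (finrank F V - j - 1) + (j + 1) := by omega
    set a := finrank F V - j - 1
    set q : ℝ := (Nat.card F : ℝ)
    set S := ∑ i ∈ Finset.range j, (finrank F V - i - 1)
    set A : ℝ := ((tuples (SelfOrthogonalAniso hs h2) j).ncard : ℝ)
    set T : ℝ := ((tuples (SelfOrthogonal B) j).ncard : ℝ)
    set A' : ℝ := ((tuples (SelfOrthogonalAniso hs h2) (j + 1)).ncard : ℝ)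
    set T' : ℝ := ((tuples (SelfOrthogonal B) (j + 1)).ncard : ℝ)
    have hq0 : 0 < q := by linarith
    constructor
    · calc A' ≤ q ^ a * A := s1
        _ ≤ q ^ a * q ^ S := by gcongr
        _ = _ := by ring
    -- New exceptional tuples come from good ones, in at most `q ^ (j + 1)` ways each, or from
    -- exceptional ones.
    · have h3 : T' - A' ≤ q ^ (j + 1) * A + q ^ (a + 1) * (T - A) := by linarith
      have hn' : q ^ finrank F V = q ^ a * q ^ (j + 1) := by rw [hnj, pow_add]
      calc q ^ finrank F V * (T' - A')
          ≤ q ^ finrank F V * (q ^ (j + 1) * A + q ^ (a + 1) * (T - A)) := by gcongr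
        _ = q ^ a * q ^ (2 * j + 2) * A + q ^ (a + 1) * (q ^ finrank F V * (T - A)) := by
          rw [mul_add, hn']
          ring
        _ ≤ q ^ a * q ^ (2 * j + 2) * q ^ S + q ^ (a + 1) * (2 * q ^ (2 * j) * q ^ S) := by
          gcongr
        _ = q ^ a * q ^ (2 * j) * q ^ S * (q ^ 2 + 2 * q) := by ring
        -- Since `q ≥ 2`, the constant `2` survives the induction.
        _ ≤ q ^ a * q ^ (2 * j) * q ^ S * (2 * q ^ 2) := by
          gcongr
          nlinarith
        _ = _ := by ring

/-- The lower bound holds at every step, since exceptional tuples only have more extensions. For the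
upper bound only the last step, with `j = k - 1`, is split: exceptional tuples add a relative error
of at most `2 * q ^ (2 * j + 1 - n) ≤ 2 / q`, absorbed by a single factor `1 + 2 / q`. -/
theorem nonalternating_bounds (hs : B.IsSymm) (hn : B.Nondegenerate) (h2 : (2 : F) = 0)
    (ha : ¬ B.IsAlt) {k : ℕ} (hk1 : 1 ≤ k) (hkn : 2 * k ≤ finrank F V) :
    (Nat.card F : ℝ) ^ (∑ j ∈ Finset.range k, (finrank F V - j - 1)) *
        (1 - 2 / (Nat.card F : ℝ)) ^ k ≤ (tuples (SelfOrthogonal B) k).ncard ∧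
      (tuples (SelfOrthogonal B) k).ncard ≤
        (Nat.card F : ℝ) ^ (∑ j ∈ Finset.range k, (finrank F V - j - 1)) *
          (1 + 2 / (Nat.card F : ℝ)) ^ k := by
  have := finite_of_finiteDimensional F V
  have hq := two_le_card_real F
  have hlow := prod_lower_bound (N := fun j => ((tuples (SelfOrthogonal B) j).ncard : ℝ)) hq
    (e := fun j => finrank F V - j - 1) ncard_tuples_selfOrthogonal_zero k fun j hj => by
      refine mul_ncard_tuples_le antitone_selfOrthogonal fun U hU hUs => ?_
      have h1 := ncard_extensions_add hs hUs
      have h3 := le_ncard_isotropicPerp hs h2 hn U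
      rw [← h1, hU] at h3
      rify at h3
      set q : ℝ := (Nat.card F : ℝ)
      have hq0 : 0 < q := by linarith
      have h4 : q ^ (j + 1) ≤ q ^ (finrank F V - j - 1) :=
        pow_le_pow_right₀ (by linarith) (by omega)
      have h5 : 0 < q ^ j := by positivity
      rw [pow_succ] at h4
      refine le_of_mul_le_mul_right ?_ hq0
      field_simp
      nlinarith
  refine ⟨hlow, ?_⟩
  obtain ⟨j, rfl⟩ : ∃ j, k = j + 1 := ⟨k - 1, by omega⟩
  obtain ⟨b1, b2⟩ := aniso_bounds hs hn h2 ha j (by omega)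
  have s2 := ncard_tuples_succ_le_aniso hs h2 hn (j := j) (by omega)
  rw [Finset.sum_range_succ]
  set a := finrank F V - j - 1
  set q : ℝ := (Nat.card F : ℝ)
  set S := ∑ i ∈ Finset.range j, (finrank F V - i - 1)
  set A : ℝ := ((tuples (SelfOrthogonalAniso hs h2) j).ncard : ℝ)
  set T : ℝ := ((tuples (SelfOrthogonal B) j).ncard : ℝ)
  set T' : ℝ := ((tuples (SelfOrthogonal B) (j + 1)).ncard : ℝ)
  have hq0 : 0 < q := by linarith
  have h3 : 1 + 2 / q ≤ (1 + 2 / q) ^ (j + 1) := by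
    refine le_self_pow₀ ?_ (by omega)
    have : 0 < 2 / q := by positivity
    linarith
  have h4 : q ^ (2 * j + 1) * q ≤ q ^ finrank F V := by
    rw [← pow_succ]
    exact pow_le_pow_right₀ (by linarith) (by omega)
  have h5 : q ^ (2 * j + 1) ≤ q ^ finrank F V / q := (le_div_iff₀ hq0).2 h4
  refine le_trans ?_ (mul_le_mul_of_nonneg_left h3 (by positivity))
  refine le_of_mul_le_mul_left ?_ (pow_pos hq0 (finrank F V))
  calc q ^ finrank F V * T' ≤ q ^ finrank F V * (q ^ a * A + q ^ (a + 1) * (T - A)) := by gcongr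
    _ = q ^ finrank F V * q ^ a * A + q ^ (a + 1) * (q ^ finrank F V * (T - A)) := by ring
    _ ≤ q ^ finrank F V * q ^ a * q ^ S + q ^ (a + 1) * (2 * q ^ (2 * j) * q ^ S) := by gcongr
    _ = q ^ (S + a) * (q ^ finrank F V + 2 * q ^ (2 * j + 1)) := by ring
    _ ≤ q ^ (S + a) * (q ^ finrank F V + 2 * (q ^ finrank F V / q)) := by gcongr
    _ = _ := by ring

theorem two_ne_zero_of_odd_card {F : Type*} [Field F] [Finite F] (h : Odd (Nat.card F)) :
    (2 : F) ≠ 0 := by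
  have := Fintype.ofFinite F
  intro h2
  have : CharP F 2 := CharTwo.of_one_ne_zero_of_two_eq_zero one_ne_zero h2
  have h3 := FiniteField.even_card_of_char_two (ringChar.eq F 2)
  rw [Nat.card_eq_fintype_card] at h
  rw [← Nat.not_even_iff_odd, Nat.even_iff] at h
  exact h h3

theorem two_eq_zero_of_even_card {F : Type*} [Field F] [Finite F] (h : Even (Nat.card F)) :
    (2 : F) = 0 := by
  have := Fintype.ofFinite F
  by_contra h2
  have h4 : ringChar F ≠ 2 := fun h5 => h2 (by
    have := ringChar.spec F 2
    rw [h5] at this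
    exact_mod_cast this.2 dvd_rfl)
  have h3 := FiniteField.odd_card_of_char_ne_two h4
  rw [Nat.card_eq_fintype_card, Nat.even_iff] at h
  omega

end Bounds

/-- If `2 k > n`, there are no spaces to consider. -/
theorem proportionAsymp_of_lt_two_mul (T : SpaceType) {n k : ℕ} (h : n < 2 * k) (g : ℝ → ℝ) :
    ProportionAsymp.{u, v} T n k g := by
  intro ε _
  refine ⟨0, fun F _ _ V _ _ _ B _ hV _ hn _ hw => ?_⟩
  have := two_mul_le_of_le_wittIndex hn hw
  omega

end BilinSpace

/-! ### Assembly of the types. -/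

theorem mainTheorem7 (n k : ℕ) (hn : 2 ≤ n) (hk : 1 ≤ k) :
    (∀ T : BilinSpace.SpaceType,
      (T = .P ∨ T = .N1 ∨ T = .N0na ∨ T = .E ∨ (T = .H ∧ 2 * k < n)) →
        BilinSpace.ProportionAsymp.{u, v} T n k
          (fun q : ℝ => q ^ (-((k + 1).choose 2 : ℤ)))) ∧
    (2 * k = n →
      BilinSpace.ProportionAsymp.{u, v} .H n k
        (fun q : ℝ => 2 * q ^ (-((k + 1).choose 2 : ℤ)))) ∧
    BilinSpace.ProportionAsymp.{u, v} .N0a n k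
      (fun q : ℝ => q ^ ((k : ℤ) - ((k + 1).choose 2 : ℤ))) := by
  rcases lt_or_ge n (2 * k) with hlt | hkn
  · exact ⟨fun T _ => BilinSpace.proportionAsymp_of_lt_two_mul T hlt _, fun h => by omega,
      BilinSpace.proportionAsymp_of_lt_two_mul _ hlt _⟩
  have hsum := BilinSpace.sum_range_sub_sub_one (show k ≤ n by omega)
  have hsum' := BilinSpace.sum_range_sub (show k ≤ n by omega)
  have hg : ∀ q : ℝ, 0 < q → q ^ (-((k + 1).choose 2 : ℤ)) * q ^ (n * k) =
      q ^ (∑ j ∈ Finset.range k, (n - j - 1)) := by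
    intro q hq
    rw [← hsum, pow_add, zpow_neg, zpow_natCast]
    field_simp
  refine ⟨fun T hT => ?_, fun h2k => ?_, ?_⟩
  · refine BilinSpace.proportionAsymp_of_bounds T hkn one_pos _
      (fun q hq => (hg q hq).trans (one_mul _).symm) ?_
    intro F _ _ V _ _ _ B hV hs hnd hB hw
    have h2k := BilinSpace.two_mul_le_of_le_wittIndex hnd hw
    rw [one_mul]
    subst hV
    -- The strict inequality `2 * k < n` required by `odd_bounds` comes from parity in type `P` and
    -- from the Witt index `n / 2 - 1` in type `E`. Type `N1` is never alternating because its
    -- dimension is odd.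
    rcases hT with rfl | rfl | rfl | rfl | ⟨rfl, hlt⟩
    · obtain ⟨h1, m, h3⟩ := hB
      exact BilinSpace.odd_bounds hs hnd (BilinSpace.two_ne_zero_of_odd_card h1) hw (by omega)
    · obtain ⟨h1, h3⟩ := hB
      exact BilinSpace.nonalternating_bounds hs hnd (BilinSpace.two_eq_zero_of_even_card h1)
        (fun ha => Nat.not_even_iff_odd.2 h3 (BilinSpace.even_finrank_of_isAlt hs hnd ha)) hk h2k
    · obtain ⟨h1, _, h3⟩ := hB
      exact BilinSpace.nonalternating_bounds hs hnd (BilinSpace.two_eq_zero_of_even_card h1)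
        h3 hk h2k
    · obtain ⟨h1, _, h3⟩ := hB
      exact BilinSpace.odd_bounds hs hnd (BilinSpace.two_ne_zero_of_odd_card h1) hw (by omega)
    · exact BilinSpace.odd_bounds hs hnd (BilinSpace.two_ne_zero_of_odd_card hB.1) hw hlt
  · refine BilinSpace.proportionAsymp_of_bounds _ hkn two_pos _
      (fun q hq => (mul_assoc _ _ _).trans (congrArg (2 * ·) (hg q hq))) ?_
    intro F _ _ V _ _ _ B hV hs hnd hB hw
    subst hV
    exact BilinSpace.hyperbolic_bounds hs hnd (BilinSpace.two_ne_zero_of_odd_card hB.1) hk hw h2k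
  · refine BilinSpace.proportionAsymp_of_bounds _ hkn one_pos
      (∑ j ∈ Finset.range k, (n - j)) (fun q hq => ?_) ?_
    · have h1 : q ^ (n * k) * q ^ k =
          q ^ (∑ j ∈ Finset.range k, (n - j)) * q ^ (k + 1).choose 2 := by
        rw [← pow_add, ← pow_add, hsum']
      rw [zpow_sub₀ hq.ne', zpow_natCast, zpow_natCast]
      field_simp
      linarith
    · intro F _ _ V _ _ _ B hV hs hnd hB hw
      rw [one_mul]
      subst hV
      exact BilinSpace.alternating_bounds hs hnd hB.2.2 hkn
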